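/- Let $\Lambda$ be a countable discrete group and let $\operatorname{Rad}(\Lambda)$ be its amenable radical, the largest amenable normal subgroup. A trace on $\Lambda$ is a positive-definite function $\varphi:\Lambda\to\mathbb C$ with $\varphi(e)=1$ and $\varphi(hgh^{-1})=\varphi(g)$ for all $g,h\in\Lambda$. A unitary representation $\pi$ of $\Lambda$ has almost invariant vectors if there are unit vectors $v_n$ with $\|\pi(g)v_n-v_n\|\to 0$ for every $g\in\Lambda$, and $\pi$ is amenable if $\pi\otimes\bar\pi$ has almost invariant vectors, where $\bar\pi$ is the dual representation. A trace is amenable if its GNS representation is amenable, and it is supported on a subgroup if it vanishes outside that subgroup. A subgroup $H\le\Lambda$ is co-amenable if $\Lambda/H$ admits a $\Lambda$-invariant mean. Suppose that every trace on $\Lambda$ is either amenable or supported on $\operatorname{Rad}(\Lambda)$. Let $\Lambda$ act by measurable, measure preserving transformations on a probability space $(\Omega,\nu)$, such that the stabilizer map $\omega\mapsto\Lambda_\omega=\{g\in\Lambda : g\omega=\omega\}$ into the space $\operatorname{Sub}(\Lambda)\subseteq\{0,1\}^\Lambda$ of subgroups, with its Chabauty topology, is $\nu$-measurable (this is automatic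 on a standard Borel space). Suppose that the action has a spectral gap, that is, the Koopman representation of $\Lambda$ on $L^2_0(\Omega,\nu)$, the orthogonal complement of the constants in $L^2(\Omega,\nu)$, has no almost invariant vectors. Then either $\Lambda_\omega\le\operatorname{Rad}(\Lambda)$ for $\nu$-almost every $\omega$, or $\Lambda_\omega$ is co-amenable in $\Lambda$ for $\nu$-almost every $\omega$. Consequently, if $\mu$ denotes the invariant random subgroup of the action, that is, the pushforward of $\nu$ under the stabilizer map, then either the set of all subgroups of $\operatorname{Rad}(\Lambda)$ has full $\mu$-measure, or the set of all co-amenable subgroups of $\Lambda$ has full $\mu$-measure. -/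

import Mathlib

open MeasureTheory Filter Topology TensorProduct
open scoped InnerProductSpace ComplexOrder ComplexConjugate

noncomputable section

namespace CharmIRS

universe u v

/-! ### Unitary representations -/

/-- A unitary representation of the (discrete) group `Λ` on `H`. -/
abbrev UnitaryRep (Λ : Type*) [Group Λ] (H : Type*) [NormedAddCommGroup H]
    [InnerProductSpace ℂ H] :=
  Λ →* (H ≃ₗᵢ[ℂ] H)

/-- A homomorphism from a group to the monoid of linear isometries takes values in invertible
isometries, and so is a unitary representation. -/
def UnitaryRep.ofIsometries {Λ : Type*} [Group Λ] {H : Type*} [NormedAddCommGroup H]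
    [InnerProductSpace ℂ H] (f : Λ →* (H →ₗᵢ[ℂ] H)) : UnitaryRep Λ H where
  toFun g :=
    { toLinearEquiv := LinearEquiv.ofLinearMap (f g).toLinearMap (f g⁻¹).toLinearMap
        (by
          ext x
          have h : f g * f g⁻¹ = 1 := by rw [← map_mul, mul_inv_cancel, map_one]
          exact DFunLike.congr_fun h x)
        (by
          ext x
          have h : f g⁻¹ * f g = 1 := by rw [← map_mul, inv_mul_cancel, map_one]
          exact DFunLike.congr_fun h x)
      norm_map' := (f g).norm_map }
  map_one' := by
    ext x
    have h : f 1 = 1 := map_one f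
    exact DFunLike.congr_fun h x
  map_mul' a b := by
    ext x
    have h : f (a * b) = f a * f b := map_mul f a b
    exact DFunLike.congr_fun h x

/-- There is a sequence of unit vectors `vₙ` with `‖π(g) vₙ - vₙ‖ → 0` for every `g`. -/
def HasAlmostInvariantVectors {Λ : Type*} [Group Λ] {H : Type*} [NormedAddCommGroup H]
    [InnerProductSpace ℂ H] (π : UnitaryRep Λ H) : Prop :=
  ∃ v : ℕ → H, (∀ n, ‖v n‖ = 1) ∧
    ∀ g : Λ, Tendsto (fun n => ‖π g (v n) - v n‖) atTop (𝓝 0)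

/-- The Hilbert space structure on the dual of a Hilbert space, for the operator norm:
`⟪⟪x, ·⟫, ⟪y, ·⟫⟫ = ⟪y, x⟫`. -/
instance dualInnerProductSpace (H : Type*) [NormedAddCommGroup H] [InnerProductSpace ℂ H]
    [CompleteSpace H] : InnerProductSpace ℂ (StrongDual ℂ H) where
  __ := (inferInstance : NormedSpace ℂ (StrongDual ℂ H))
  inner a b := ⟪(InnerProductSpace.toDual ℂ H).symm b, (InnerProductSpace.toDual ℂ H).symm a⟫_ℂ
  norm_sq_eq_re_inner a := by
    rw [← (InnerProductSpace.toDual ℂ H).symm.norm_map a]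
    exact norm_sq_eq_re_inner _
  conj_inner_symm a b := inner_conj_symm _ _
  add_left a b c := by rw [map_add, inner_add_right]
  smul_left a b r := by
    rw [LinearIsometryEquiv.map_smulₛₗ, inner_smul_right]

/-- The dual (contragredient) representation `(π̄(g) a)(x) = a(π(g)⁻¹ x)` on the dual of `H`. -/
def UnitaryRep.dual {Λ : Type*} [Group Λ] {H : Type*} [NormedAddCommGroup H]
    [InnerProductSpace ℂ H] [CompleteSpace H] (π : UnitaryRep Λ H) :
    UnitaryRep Λ (StrongDual ℂ H) :=
  UnitaryRep.ofIsometries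
    { toFun := fun g =>
        { toFun := fun a => a.comp (π g⁻¹).toContinuousLinearEquiv.toContinuousLinearMap
          map_add' := fun _ _ => rfl
          map_smul' := fun _ _ => rfl
          norm_map' := fun a => ContinuousLinearMap.opNorm_comp_linearIsometryEquiv a (π g⁻¹) }
      map_one' := by
        ext a x
        change a (π 1⁻¹ x) = a x
        rw [inv_one, map_one]
        rfl
      map_mul' := fun g h => by
        ext a x
        change a (π (g * h)⁻¹ x) = a (π h⁻¹ (π g⁻¹ x))
        rw [mul_inv_rev, map_mul]
        rfl }

/-- The Hilbert space tensor product. -/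
abbrev HilbertTensor (H K : Type*) [NormedAddCommGroup H] [InnerProductSpace ℂ H]
    [NormedAddCommGroup K] [InnerProductSpace ℂ K] :=
  UniformSpace.Completion (H ⊗[ℂ] K)

/-- The extension of a linear isometry to the completions. -/
def completionIsometry {E : Type*} [NormedAddCommGroup E] [InnerProductSpace ℂ E]
    (f : E →ₗᵢ[ℂ] E) : UniformSpace.Completion E →ₗᵢ[ℂ] UniformSpace.Completion E where
  toLinearMap := f.toContinuousLinearMap.completion.toLinearMap
  norm_map' x := by
    induction x using UniformSpace.Completion.induction_on with
    | hp =>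
      exact isClosed_eq (continuous_norm.comp f.toContinuousLinearMap.completion.continuous)
        continuous_norm
    | ih a =>
      change ‖f.toContinuousLinearMap.completion (a : UniformSpace.Completion E)‖ = _
      rw [ContinuousLinearMap.completion_apply_coe]
      simp

theorem completionIsometry_coe {E : Type*} [NormedAddCommGroup E] [InnerProductSpace ℂ E]
    (f : E →ₗᵢ[ℂ] E) (a : E) :
    completionIsometry f (a : UniformSpace.Completion E) = (f a : UniformSpace.Completion E) :=
  ContinuousLinearMap.completion_apply_coe f.toContinuousLinearMap a

theorem completionIsometry_ext {E : Type*} [NormedAddCommGroup E] [InnerProductSpace ℂ E]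
    {f g : UniformSpace.Completion E →ₗᵢ[ℂ] UniformSpace.Completion E}
    (h : ∀ a : E, f (a : UniformSpace.Completion E) = g (a : UniformSpace.Completion E)) :
    f = g := by
  ext x
  induction x using UniformSpace.Completion.induction_on with
  | hp => exact isClosed_eq f.continuous g.continuous
  | ih a => exact h a

/-- The tensor product representation `(π ⊗ σ)(g) = π(g) ⊗ σ(g)` on the Hilbert space tensor
product. -/
def UnitaryRep.tensor {Λ : Type*} [Group Λ] {H K : Type*} [NormedAddCommGroup H]
    [InnerProductSpace ℂ H] [NormedAddCommGroup K] [InnerProductSpace ℂ K]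
    (π : UnitaryRep Λ H) (σ : UnitaryRep Λ K) : UnitaryRep Λ (HilbertTensor H K) :=
  UnitaryRep.ofIsometries
    { toFun := fun g => completionIsometry
        (TensorProduct.mapIsometry (π g).toLinearIsometry (σ g).toLinearIsometry)
      map_one' := by
        apply completionIsometry_ext
        intro a
        rw [completionIsometry_coe, map_one, map_one]
        exact congrArg _ (DFunLike.congr_fun TensorProduct.mapIsometry_id_id a)
      map_mul' := fun g h => by
        apply completionIsometry_ext
        intro a
        change _ = completionIsometry _ (completionIsometry _ _)
        rw [completionIsometry_coe, completionIsometry_coe, completionIsometry_coe, map_mul,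
          map_mul]
        refine congrArg _ ?_
        induction a with
        | zero => simp
        | tmul x y => rfl
        | add x y hx hy => rw [map_add, map_add, map_add, hx, hy] }

/-- A unitary representation `π` is amenable if `π ⊗ π̄` has almost invariant vectors. -/
def UnitaryRep.IsAmenable {Λ : Type*} [Group Λ] {H : Type*} [NormedAddCommGroup H]
    [InnerProductSpace ℂ H] [CompleteSpace H] (π : UnitaryRep Λ H) : Prop :=
  HasAlmostInvariantVectors (π.tensor π.dual)

/-! ### Traces -/

/-- Positive-definite functions: `∑ᵢⱼ conj αᵢ αⱼ φ(gᵢ⁻¹ gⱼ)` is a nonnegative real number. -/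
def IsPositiveDefinite {Λ : Type*} [Group Λ] (φ : Λ → ℂ) : Prop :=
  ∀ (n : ℕ) (g : Fin n → Λ) (α : Fin n → ℂ),
    0 ≤ ∑ i, ∑ j, conj (α i) * α j * φ ((g i)⁻¹ * g j)

/-- A trace: a normalized conjugation invariant positive-definite function. -/
structure IsTrace {Λ : Type*} [Group Λ] (φ : Λ → ℂ) : Prop where
  posDef : IsPositiveDefinite φ
  map_one : φ 1 = 1
  conj_inv : ∀ g h : Λ, φ (h * g * h⁻¹) = φ g

/-- `(H, π, ξ)` is a GNS triplet of `φ`: `ξ` is a cyclic vector and `φ(g) = ⟨π(g) ξ, ξ⟩`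
(the inner product of Mathlib is conjugate linear in its first argument). -/
structure IsGNSTriplet {Λ : Type*} [Group Λ] (φ : Λ → ℂ) {H : Type*} [NormedAddCommGroup H]
    [InnerProductSpace ℂ H] (π : UnitaryRep Λ H) (ξ : H) : Prop where
  cyclic : (Submodule.span ℂ (Set.range fun g : Λ => π g ξ)).topologicalClosure = ⊤
  apply_eq : ∀ g : Λ, φ g = ⟪ξ, π g ξ⟫_ℂ

/-- A trace is amenable if its GNS representation (which is unique up to equivalence) is
amenable. -/
def IsAmenableTrace {Λ : Type u} [Group Λ] (φ : Λ → ℂ) : Prop :=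
  ∃ (H : Type u) (_ : NormedAddCommGroup H) (_ : InnerProductSpace ℂ H) (_ : CompleteSpace H)
    (π : UnitaryRep Λ H) (ξ : H), IsGNSTriplet φ π ξ ∧ π.IsAmenable

/-- `φ` vanishes outside the subgroup `N`. -/
def IsSupportedOn {Λ : Type*} [Group Λ] (φ : Λ → ℂ) (N : Subgroup Λ) : Prop :=
  ∀ g : Λ, g ∉ N → φ g = 0

/-! ### Amenability and co-amenability -/

/-- The space `ℓ^∞(X)` of bounded real functions on a set. -/
def boundedFunctions (X : Type*) : Submodule ℝ (X → ℝ) where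
  carrier := {f | ∃ C : ℝ, ∀ x, |f x| ≤ C}
  add_mem' := by
    rintro f g ⟨C, hC⟩ ⟨D, hD⟩
    exact ⟨C + D, fun x => (abs_add_le _ _).trans (add_le_add (hC x) (hD x))⟩
  zero_mem' := ⟨0, fun x => by simp⟩
  smul_mem' := by
    rintro c f ⟨C, hC⟩
    refine ⟨|c| * C, fun x => ?_⟩
    rw [Pi.smul_apply, smul_eq_mul, abs_mul]
    exact mul_le_mul_of_nonneg_left (hC x) (abs_nonneg c)

/-- The constant function `1`. -/
def boundedOne (X : Type*) : boundedFunctions X :=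
  ⟨fun _ => 1, 1, fun _ => by simp⟩

/-- The translate `x ↦ f (g • x)`. -/
def boundedTranslate {G X : Type*} [Group G] [MulAction G X] (g : G) (f : boundedFunctions X) :
    boundedFunctions X :=
  ⟨fun x => f.1 (g • x), f.2.imp fun _ hC x => hC (g • x)⟩

/-- The `G`-set `X` carries a `G`-invariant mean: a positive normalized linear functional on
`ℓ^∞(X)` that is invariant under translations. -/
def HasInvariantMean (G X : Type*) [Group G] [MulAction G X] : Prop :=
  ∃ m : boundedFunctions X →ₗ[ℝ] ℝ,
    (∀ f : boundedFunctions X, (∀ x, 0 ≤ f.1 x) → 0 ≤ m f) ∧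
    m (boundedOne X) = 1 ∧
    ∀ (g : G) (f : boundedFunctions X), m (boundedTranslate g f) = m f

/-- Amenability of a discrete group. -/
def IsAmenableGroup (G : Type*) [Group G] : Prop :=
  HasInvariantMean G G

/-- `H` is co-amenable in `Λ` if `Λ ⧸ H` carries a `Λ`-invariant mean. -/
def IsCoamenable {Λ : Type*} [Group Λ] (H : Subgroup Λ) : Prop :=
  HasInvariantMean Λ (Λ ⧸ H)

/-- The amenable radical: the subgroup generated by all amenable normal subgroups, which is the
largest amenable normal subgroup. -/
def amenableRadical (Λ : Type*) [Group Λ] : Subgroup Λ :=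
  sSup {N : Subgroup Λ | N.Normal ∧ IsAmenableGroup N}

/-! ### The space of subgroups -/

open scoped Classical in
/-- The embedding of the set of subgroups in `{0, 1}^Λ`. -/
def subgroupIndicator (Λ : Type*) [Group Λ] (H : Subgroup Λ) : Λ → Bool :=
  fun g => decide (g ∈ H)

/-- The Chabauty topology on the set of subgroups of a discrete group, induced from the product
topology of `{0, 1}^Λ`. -/
instance chabautyTopology (Λ : Type*) [Group Λ] : TopologicalSpace (Subgroup Λ) :=
  TopologicalSpace.induced (subgroupIndicator Λ) inferInstance

instance chabautyMeasurableSpace (Λ : Type*) [Group Λ] : MeasurableSpace (Subgroup Λ) :=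
  borel (Subgroup Λ)

instance chabautyBorelSpace (Λ : Type*) [Group Λ] : BorelSpace (Subgroup Λ) := ⟨rfl⟩

/-! ### Probability measure preserving actions -/

section Action

variable (Λ : Type*) [Group Λ] {Ω : Type*} [MeasurableSpace Ω] [MulAction Λ Ω]
  [MeasurableConstSMul Λ Ω] (ν : Measure Ω) [SMulInvariantMeasure Λ Ω ν]

/-- The Koopman representation `(κ(g) f)(ω) = f(g⁻¹ ω)` on `L²(Ω, ν)`. -/
def koopman : UnitaryRep Λ (Lp ℂ 2 ν) :=
  UnitaryRep.ofIsometries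
    { toFun := fun g =>
        Lp.compMeasurePreservingₗᵢ ℂ (fun ω : Ω => g⁻¹ • ω) (measurePreserving_smul g⁻¹ ν)
      map_one' := by
        apply LinearIsometry.ext
        intro f
        change DomMulAct.mk (1 : Λ)⁻¹ • f = f
        rw [inv_one, DomMulAct.mk_one, one_smul]
      map_mul' := fun g h => by
        apply LinearIsometry.ext
        intro f
        change DomMulAct.mk (g * h)⁻¹ • f = DomMulAct.mk g⁻¹ • DomMulAct.mk h⁻¹ • f
        rw [mul_inv_rev, DomMulAct.mk_mul, mul_smul] }

/-- `L²₀(Ω, ν)`: the orthogonal complement of the constant functions in `L²(Ω, ν)`. -/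
def LTwoZero {Ω : Type*} [MeasurableSpace Ω] (ν : Measure Ω) [IsFiniteMeasure ν] :
    Submodule ℂ (Lp ℂ 2 ν) :=
  (Submodule.span ℂ (Set.range fun c : ℂ => Lp.const 2 ν c))ᗮ

theorem koopman_const [IsFiniteMeasure ν] (g : Λ) (c : ℂ) :
    koopman Λ ν g (Lp.const 2 ν c) = Lp.const 2 ν c :=
  DomMulAct.smul_Lp_const (DomMulAct.mk g⁻¹) c

theorem koopman_mem [IsFiniteMeasure ν] (g : Λ) (f : Lp ℂ 2 ν) (hf : f ∈ LTwoZero ν) :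
    koopman Λ ν g f ∈ LTwoZero ν := by
  rw [LTwoZero, Submodule.mem_orthogonal] at hf ⊢
  intro w hw
  have hfix : koopman Λ ν g w = w := by
    induction hw using Submodule.span_induction with
    | mem x hx => obtain ⟨c, rfl⟩ := hx; exact koopman_const Λ ν g c
    | zero => exact map_zero _
    | add x y _ _ hx hy => rw [map_add, hx, hy]
    | smul a x _ hx => rw [map_smul, hx]
  rw [← hfix, LinearIsometryEquiv.inner_map_map]
  exact hf w hw

/-- The Koopman representation on `L²₀(Ω, ν)`. -/
def koopmanZero [IsFiniteMeasure ν] : UnitaryRep Λ (LTwoZero ν) :=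
  UnitaryRep.ofIsometries
    { toFun := fun g =>
        { toLinearMap := (koopman Λ ν g).toLinearEquiv.toLinearMap.restrict (koopman_mem Λ ν g)
          norm_map' := fun f => (koopman Λ ν g).norm_map f }
      map_one' := by
        apply LinearIsometry.ext
        intro f
        apply Subtype.ext
        change koopman Λ ν 1 f = f
        rw [map_one]
        rfl
      map_mul' := fun g h => by
        apply LinearIsometry.ext
        intro f
        apply Subtype.ext
        change koopman Λ ν (g * h) f = koopman Λ ν g (koopman Λ ν h f)
        rw [map_mul]
        rfl }

/-- The action has a spectral gap: the Koopman representation on `L²₀(Ω, ν)` has no almost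
invariant vectors. -/
def HasSpectralGap [IsFiniteMeasure ν] : Prop :=
  ¬ HasAlmostInvariantVectors (koopmanZero Λ ν)

/-- The invariant random subgroup of the action: the pushforward of `ν` under the stabilizer
map. -/
def stabilizerIRS : Measure (Subgroup Λ) :=
  ν.map (fun ω : Ω => MulAction.stabilizer Λ ω)

end Action

end CharmIRS

end

noncomputable section

namespace CharmIRS

/-! ### Invariant means from almost invariant finitely supported functions -/

/-! The fixed-point function `φ(g) = ν {ω | g ω = ω}` is the average over `ω` of the indicators of
the stabilizers `Λ_ω`. It is a trace (`isTrace_actionTrace`), so the hypothesis on traces applies to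
it. If `φ` vanishes off the radical, then each `g` outside the radical fixes almost no point, and
countability of `Λ` puts `Λ_ω` inside the radical for almost every `ω`.

Suppose instead that the GNS representation `π` of `φ` is amenable, and let `σ` be its dual. Morally
`π` lies in the direct integral of the quasi-regular representations on `ℓ²(Λ ⧸ Λ_ω)`, so almost
invariant vectors of `π ⊗ σ` should produce almost invariant vectors in `ℓ²(Λ ⧸ Λ_ω, V)`, where `V`
is the space of `σ`. No direct integral is needed: the vectors `∑ π(sᵢ) ξ ⊗ vᵢ` are dense, and their
matrix coefficients (`kernelForm`) are linear in `φ`, hence are integrals over `ω` of the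
coefficients of `∑ sᵢ Λ_ω ⊗ vᵢ`. For given `(F, ε)`, the set of `ω` admitting an `(F, ε)`-invariant
vector is therefore not null. It is `Λ`-invariant, and the spectral gap implies ergodicity, so it is
conull (`ae_stabilizer_mem_approxInvariant`). Countably many pairs `(F, ε)` suffice.

For a subgroup `H` good for all these pairs, the functions `x ↦ ‖f(x)‖²`, normalized, are almost
invariant probability densities on `Λ ⧸ H`, and a limit of them is an invariant mean
(`isCoamenable_of_approxInvariant`). Only the almost invariant vectors of `π ⊗ σ` matter; that `σ`
is dual to `π` plays no further role. -/

theorem hasInvariantMean_of_reiter {G X : Type*} [Group G] [MulAction G X]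
    (h : ∀ (F : Finset G) (δ : ℝ), 0 < δ → ∃ p : X → ℝ, p.support.Finite ∧ (∀ x, 0 ≤ p x) ∧
      ∑' x, p x = 1 ∧ ∀ g ∈ F, ∑' x, |p (g⁻¹ • x) - p x| ≤ δ) :
    HasInvariantMean G X := by
  have hpos : ∀ i : Finset G × ℕ, (0 : ℝ) < 1 / ((i.2 : ℝ) + 1) := fun i => by positivity
  choose p hfin hnn hone hinv using fun i : Finset G × ℕ => h i.1 _ (hpos i)
  have hsum : ∀ i, Summable (p i) := fun i => summable_of_hasFiniteSupport (hfin i)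
  have hsumf : ∀ i (f : X → ℝ), Summable fun x => p i x * f x := fun i f =>
    summable_of_hasFiniteSupport ((hfin i).subset fun x hx => by
      simp only [Function.mem_support] at hx ⊢; exact left_ne_zero_of_mul hx)
  classical
  -- Along this ultrafilter every `g` eventually lies in `F` and `1 / (n + 1)` tends to `0`; the
  -- mean of `f` is the limit of its `p i`-averages.
  let U : Ultrafilter (Finset G × ℕ) := Ultrafilter.of atTop
  have hU : (U : Filter (Finset G × ℕ)) ≤ atTop := Ultrafilter.of_le atTop
  have hlim : ∀ f : boundedFunctions X, ∃ L : ℝ,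
      Tendsto (fun i => ∑' x, p i x * f.1 x) U (𝓝 L) := by
    intro f
    obtain ⟨C, hC⟩ := f.2
    have hmem : ∀ i, ∑' x, p i x * f.1 x ∈ Set.Icc (-C) C := by
      intro i
      constructor
      · calc -C = ∑' x, p i x * -C := by rw [tsum_mul_right, hone, one_mul]
          _ ≤ _ := (hsumf i fun _ => -C).tsum_le_tsum
            (fun x => mul_le_mul_of_nonneg_left (abs_le.1 (hC x)).1 (hnn i x)) (hsumf i f.1)
      · calc _ ≤ ∑' x, p i x * C := (hsumf i f.1).tsum_le_tsum
              (fun x => mul_le_mul_of_nonneg_left (abs_le.1 (hC x)).2 (hnn i x)) (hsumf i _)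
          _ = C := by rw [tsum_mul_right, hone, one_mul]
    obtain ⟨L, -, hL⟩ := (isCompact_Icc (a := -C) (b := C)).ultrafilter_le_nhds'
      (U.map fun i => ∑' x, p i x * f.1 x) 
      (Ultrafilter.mem_map.2 (Filter.univ_mem' hmem))
    exact ⟨L, hL⟩
  choose m hm using hlim
  refine ⟨⟨⟨m, fun f g => ?_⟩, fun c f => ?_⟩, fun f hf => ?_, ?_, fun g f => ?_⟩
  · refine tendsto_nhds_unique (hm (f + g)) (((hm f).add (hm g)).congr fun i => ?_)
    rw [← (hsumf i f.1).tsum_add (hsumf i g.1)]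
    exact tsum_congr fun x => (mul_add _ _ _).symm
  · refine tendsto_nhds_unique (hm (c • f)) (((hm f).const_mul c).congr fun i => ?_)
    rw [← tsum_mul_left]
    exact tsum_congr fun x => mul_left_comm _ _ _
  · exact ge_of_tendsto' (hm f) fun i => tsum_nonneg fun x => mul_nonneg (hnn i x) (hf x)
  · refine tendsto_nhds_unique (hm (boundedOne X)) (tendsto_const_nhds.congr fun i => ?_)
    simp only [boundedOne, mul_one, hone]
  · obtain ⟨C, hC⟩ := f.2
    have hz : Tendsto (fun i : Finset G × ℕ => C * (1 / ((i.2 : ℝ) + 1))) U (𝓝 0) := by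
      have h1 : Tendsto (fun i : Finset G × ℕ => i.2) U atTop := by
        refine Tendsto.mono_left ?_ hU
        rw [← prod_atTop_atTop_eq]
        exact tendsto_snd
      simpa using (tendsto_one_div_add_atTop_nhds_zero_nat.comp h1).const_mul C
    have hd := (hm (boundedTranslate g f)).sub (hm f)
    have : m (boundedTranslate g f) - m f = 0 := by
      refine tendsto_nhds_unique hd (squeeze_zero_norm' ?_ hz)
      have hg : ∀ᶠ i : Finset G × ℕ in U, g ∈ i.1 := by
        refine hU ?_
        filter_upwards [eventually_ge_atTop (({g}, 0) : Finset G × ℕ)] with i hi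
        exact hi.1 (Finset.mem_singleton_self g)
      filter_upwards [hg] with i hi
      have e1 : ∑' x, p i x * (boundedTranslate g f).1 x = ∑' x, p i (g⁻¹ • x) * f.1 x := by
        rw [← (MulAction.toPerm g : Equiv.Perm X).tsum_eq fun x => p i (g⁻¹ • x) * f.1 x]
        exact tsum_congr fun x => by simp [boundedTranslate]
      have hfin' : (Function.support fun x => p i (g⁻¹ • x)).Finite :=
        (hfin i).preimage (MulAction.injective g⁻¹).injOn
      have s1 : Summable fun x => p i (g⁻¹ • x) * f.1 x :=
        summable_of_hasFiniteSupport (hfin'.subset fun x hx => by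
          simp only [Function.mem_support] at hx ⊢; exact left_ne_zero_of_mul hx)
      have s2 : Summable fun x => |p i (g⁻¹ • x) - p i x| :=
        ((summable_of_hasFiniteSupport hfin').sub (hsum i)).abs
      have hb : ∀ x, ‖p i (g⁻¹ • x) * f.1 x - p i x * f.1 x‖ ≤ C * |p i (g⁻¹ • x) - p i x| := by
        intro x
        rw [← sub_mul, norm_mul, mul_comm C]
        exact mul_le_mul_of_nonneg_left (hC x) (norm_nonneg _)
      -- The bound `C` can be negative only if `X` is empty, which total mass `1` excludes.
      have hC0 : 0 ≤ C ∨ IsEmpty X := by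
        by_cases hX : Nonempty X
        · exact Or.inl ((abs_nonneg _).trans (hC hX.some))
        · exact Or.inr (not_nonempty_iff.1 hX)
      rw [e1, ← s1.tsum_sub (hsumf i f.1)]
      rcases hC0 with hC0 | hX
      · calc _ ≤ ∑' x, C * |p i (g⁻¹ • x) - p i x| :=
              tsum_of_norm_bounded (s2.mul_left C).hasSum hb
          _ ≤ _ := by
            rw [tsum_mul_left]
            exact mul_le_mul_of_nonneg_left (hinv i g hi) hC0
      · have := hone i
        simp at this
    exact sub_eq_zero.1 this

/-! ### Forms on finitely supported functions attached to a subgroup -/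

open scoped Classical in
/-- The image of `∑ᵢ sᵢ ⊗ vᵢ` in the space of functions from `Λ ⧸ H` to `V`. -/
def cosetVector {Λ V : Type*} [Group Λ] [AddCommMonoid V] (H : Subgroup Λ)
    {n : ℕ} (s : Fin n → Λ) (v : Fin n → V) (x : Λ ⧸ H) : V :=
  ∑ i, if (s i : Λ ⧸ H) = x then v i else 0

theorem cosetVector_support_finite {Λ V : Type*} [Group Λ] [AddCommMonoid V] (H : Subgroup Λ)
    {n : ℕ} (s : Fin n → Λ) (v : Fin n → V) :
    (Function.support (cosetVector H s v)).Finite := by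
  refine (Set.finite_range fun i => (s i : Λ ⧸ H)).subset fun x hx => ?_
  by_contra hne
  refine hx (Finset.sum_eq_zero fun i _ => if_neg fun h => hne ⟨i, h⟩)

section Form

variable {Λ : Type*} [Group Λ] {V : Type*} [NormedAddCommGroup V] [InnerProductSpace ℂ V]

open scoped Classical in
/-- The indicator function of a subgroup. -/
def subgroupChar (H : Subgroup Λ) (g : Λ) : ℂ := if g ∈ H then 1 else 0

/-- The matrix coefficient of `g` at the vector `∑ᵢ sᵢ ⊗ vᵢ` for the kernel `φ` on `Λ`. -/
def kernelForm (φ : Λ → ℂ) (σ : UnitaryRep Λ V) (g : Λ) {n : ℕ} (s : Fin n → Λ)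
    (v : Fin n → V) : ℂ :=
  ∑ i, ∑ j, φ ((g * s i)⁻¹ * s j) * ⟪σ g (v i), v j⟫_ℂ

/-- The kernel `1_H((g sᵢ)⁻¹ sⱼ)` detects whether `g sᵢ H = sⱼ H`, so the form is a matrix
coefficient of the representation on `ℓ²(Λ ⧸ H, V)`. In the expansion over cosets, the pair `(i, j)`
contributes only at `x = sⱼ H`. -/
theorem kernelForm_subgroupChar (H : Subgroup Λ) (σ : UnitaryRep Λ V) (g : Λ) {n : ℕ}
    (s : Fin n → Λ) (v : Fin n → V) :
    kernelForm (subgroupChar H) σ g s v =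
      ∑' x : Λ ⧸ H, ⟪σ g (cosetVector H s v (g⁻¹ • x)), cosetVector H s v x⟫_ℂ := by
  classical
  have key : ∀ x : Λ ⧸ H, ⟪σ g (cosetVector H s v (g⁻¹ • x)), cosetVector H s v x⟫_ℂ =
      ∑ i, ∑ j, if x = (s j : Λ ⧸ H) then
        subgroupChar H ((g * s i)⁻¹ * s j) * ⟪σ g (v i), v j⟫_ℂ else 0 := by
    intro x
    rw [cosetVector, cosetVector, map_sum, sum_inner]
    refine Finset.sum_congr rfl fun i _ => ?_
    rw [inner_sum]
    refine Finset.sum_congr rfl fun j _ => ?_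
    by_cases hj : (s j : Λ ⧸ H) = x
    · subst hj
      have : ((s i : Λ ⧸ H) = g⁻¹ • (s j : Λ ⧸ H)) ↔ (g * s i)⁻¹ * s j ∈ H := by
        rw [eq_inv_smul_iff, ← QuotientGroup.eq]
        rfl
      by_cases hi : (g * s i)⁻¹ * s j ∈ H
      · simp only [if_pos (this.2 hi), if_true, subgroupChar, if_pos hi, one_mul]
      · simp only [if_neg (mt this.1 hi), if_true, subgroupChar, if_neg hi, zero_mul, map_zero,
          inner_zero_left]
    · rw [if_neg hj, if_neg (Ne.symm hj), inner_zero_right]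
  simp only [key]
  have hs : ∀ i j, Summable fun x : Λ ⧸ H => if x = (s j : Λ ⧸ H) then
        subgroupChar H ((g * s i)⁻¹ * s j) * ⟪σ g (v i), v j⟫_ℂ else 0 := fun i j =>
    (hasSum_ite_eq _ _).summable
  rw [Summable.tsum_finsetSum fun i _ => summable_sum fun j _ => hs i j]
  refine Finset.sum_congr rfl fun i _ => ?_
  rw [Summable.tsum_finsetSum fun j _ => hs i j]
  exact Finset.sum_congr rfl fun j _ =>
    (tsum_ite_eq (s j : Λ ⧸ H) fun _ => subgroupChar H ((g * s i)⁻¹ * s j) * ⟪σ g (v i), v j⟫_ℂ).symm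

/-- The subgroups `H` such that `Λ ⧸ H` has `(F, ε)`-invariant finitely supported functions with
values in `V`. -/
def approxInvariant (σ : UnitaryRep Λ V) (F : Finset Λ) (ε : ℝ) : Set (Subgroup Λ) :=
  {H | ∃ (n : ℕ) (s : Fin n → Λ) (v : Fin n → V),
    ∑ g ∈ F, ((kernelForm (subgroupChar H) σ 1 s v).re - (kernelForm (subgroupChar H) σ g s v).re) <
      ε * (kernelForm (subgroupChar H) σ 1 s v).re}

theorem continuous_subgroupChar (g : Λ) :
    Continuous fun H : Subgroup Λ => subgroupChar H g := by
  have : (fun H : Subgroup Λ => subgroupChar H g) =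
      (fun b : Bool => if b then (1 : ℂ) else 0) ∘ (fun f : Λ → Bool => f g) ∘
        subgroupIndicator Λ := by
    ext H
    by_cases h : g ∈ H <;> simp [subgroupChar, subgroupIndicator, h]
  rw [this]
  exact continuous_of_discreteTopology.comp ((continuous_apply g).comp continuous_induced_dom)

/-- For fixed `s` and `v` the condition is a strict inequality in finitely many coordinates of `H`.
Openness gives measurability although the union over `v` may be uncountable. -/
theorem isOpen_approxInvariant (σ : UnitaryRep Λ V) (F : Finset Λ) (ε : ℝ) :
    IsOpen (approxInvariant σ F ε) := by
  simp only [approxInvariant, Set.ofPred_exists]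
  refine isOpen_iUnion fun n => isOpen_iUnion fun s => isOpen_iUnion fun v => ?_
  have hc : ∀ g, Continuous fun H : Subgroup Λ => (kernelForm (subgroupChar H) σ g s v).re :=
    fun g => Complex.continuous_re.comp <| continuous_finsetSum _ fun i _ =>
      continuous_finsetSum _ fun j _ => (continuous_subgroupChar _).mul continuous_const
  exact isOpen_lt (continuous_finsetSum _ fun g _ => (hc 1).sub (hc g))
    (continuous_const.mul (hc 1))

/-- The stabilizer of `k • ω` is `k Λ_ω k⁻¹`, and right multiplication by `k` induces an equivariant
bijection from its coset space to `Λ ⧸ Λ_ω`. -/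
theorem stabilizer_smul_mem_approxInvariant {Ω : Type*} [MulAction Λ Ω] (σ : UnitaryRep Λ V)
    (F : Finset Λ) (ε : ℝ) (k : Λ) (ω : Ω)
    (h : MulAction.stabilizer Λ (k • ω) ∈ approxInvariant σ F ε) :
    MulAction.stabilizer Λ ω ∈ approxInvariant σ F ε := by
  obtain ⟨n, s, v, h⟩ := h
  refine ⟨n, fun i => s i * k, v, ?_⟩
  have e : ∀ g, kernelForm (subgroupChar (MulAction.stabilizer Λ ω)) σ g (fun i => s i * k) v =
      kernelForm (subgroupChar (MulAction.stabilizer Λ (k • ω))) σ g s v := by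
    intro g
    refine Finset.sum_congr rfl fun i _ => Finset.sum_congr rfl fun j _ => ?_
    congr 1
    have : (g * (s i * k))⁻¹ * (s j * k) ∈ MulAction.stabilizer Λ ω ↔
        (g * s i)⁻¹ * s j ∈ MulAction.stabilizer Λ (k • ω) := by
      simp only [MulAction.mem_stabilizer_iff, mul_smul, mul_inv_rev, inv_smul_eq_iff]
    simp only [subgroupChar]
    by_cases hm : (g * s i)⁻¹ * s j ∈ MulAction.stabilizer Λ (k • ω)
    · rw [if_pos hm, if_pos (this.2 hm)]
    · rw [if_neg hm, if_neg (mt this.1 hm)]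
  simpa only [e] using h

/-- Weighted AM-GM applied to `‖u - w‖ (‖u‖ + ‖w‖)`. This additive form can be summed over cosets
term by term, in place of Cauchy–Schwarz for series. -/
theorem abs_norm_sq_sub_le (u w : V) {δ : ℝ} (hδ : 0 < δ) :
    |‖u‖ ^ 2 - ‖w‖ ^ 2| ≤ (1 / δ) * ((‖u‖ ^ 2 + ‖w‖ ^ 2) / 2 - (⟪u, w⟫_ℂ).re) +
      δ * (‖u‖ ^ 2 + ‖w‖ ^ 2) := by
  have h1 : ‖u - w‖ ^ 2 = ‖u‖ ^ 2 - 2 * (⟪u, w⟫_ℂ).re + ‖w‖ ^ 2 := by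
    simpa using norm_sub_sq (𝕜 := ℂ) u w
  have h2 : |‖u‖ - ‖w‖| ≤ ‖u - w‖ := abs_norm_sub_norm_le u w
  have h3 : |‖u‖ ^ 2 - ‖w‖ ^ 2| ≤ ‖u - w‖ * (‖u‖ + ‖w‖) := by
    rw [sq_sub_sq, abs_mul, abs_of_nonneg (by positivity : 0 ≤ ‖u‖ + ‖w‖), mul_comm]
    gcongr
  have h4 : (‖u‖ ^ 2 + ‖w‖ ^ 2) / 2 - (⟪u, w⟫_ℂ).re = ‖u - w‖ ^ 2 / 2 := by rw [h1]; ring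
  rw [h4]
  refine h3.trans ?_
  have h5 : 1 / δ * (‖u - w‖ ^ 2 / 2) + δ * (‖u‖ ^ 2 + ‖w‖ ^ 2) - ‖u - w‖ * (‖u‖ + ‖w‖) =
      ((‖u - w‖ - δ * (‖u‖ + ‖w‖)) ^ 2 + δ ^ 2 * (‖u‖ - ‖w‖) ^ 2) / (2 * δ) := by
    field_simp
    ring
  have h6 : 0 ≤ ((‖u - w‖ - δ * (‖u‖ + ‖w‖)) ^ 2 + δ ^ 2 * (‖u‖ - ‖w‖) ^ 2) / (2 * δ) := by
    positivity
  linarith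

theorem isCoamenable_of_approxInvariant (σ : UnitaryRep Λ V) (H : Subgroup Λ)
    (h : ∀ (F : Finset Λ) (n : ℕ), H ∈ approxInvariant σ F (1 / ((n : ℝ) + 1))) :
    IsCoamenable H := by
  refine hasInvariantMean_of_reiter fun F δ hδ => ?_
  -- With AM-GM parameter `δ / 3`, the defect `(δ / 3)² Q` contributes `δ / 3` after normalization
  -- and the two norm terms contribute `2 δ / 3`.
  obtain ⟨N, hN⟩ := exists_nat_one_div_lt (by positivity : 0 < (δ / 3) ^ 2)
  obtain ⟨n, s, v, hlt⟩ := h F N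
  set f := cosetVector H s v with hf
  set Q := ∑' x, ‖f x‖ ^ 2 with hQ
  have hfin : (Function.support fun x => ‖f x‖ ^ 2).Finite :=
    (cosetVector_support_finite H s v).subset fun x hx hx' => hx (by simp [f, hx'])
  have hsum : Summable fun x => ‖f x‖ ^ 2 := summable_of_hasFiniteSupport hfin
  have hsumg : ∀ g : Λ, Summable fun x => ‖f (g⁻¹ • x)‖ ^ 2 := fun g =>
    summable_of_hasFiniteSupport (hfin.preimage (MulAction.injective g⁻¹).injOn)
  have htsg : ∀ g : Λ, ∑' x, ‖f (g⁻¹ • x)‖ ^ 2 = Q := fun g =>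
    (MulAction.toPerm g⁻¹ : Equiv.Perm (Λ ⧸ H)).tsum_eq fun x => ‖f x‖ ^ 2
  have hsumi : ∀ g : Λ, Summable fun x => ⟪σ g (f (g⁻¹ • x)), f x⟫_ℂ := fun g =>
    summable_of_hasFiniteSupport ((cosetVector_support_finite H s v).subset
      fun x hx hx' => hx (by simp [f, hx']))
  have hB : ∀ g : Λ, (kernelForm (subgroupChar H) σ g s v).re =
      ∑' x, (⟪σ g (f (g⁻¹ • x)), f x⟫_ℂ).re := fun g => by
    rw [kernelForm_subgroupChar, Complex.re_tsum (hsumi g)]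
  have hsumr : ∀ g : Λ, Summable fun x => (⟪σ g (f (g⁻¹ • x)), f x⟫_ℂ).re := fun g =>
    Complex.reCLM.summable (hsumi g)
  have hB1 : (kernelForm (subgroupChar H) σ 1 s v).re = Q := by
    rw [hB]
    refine tsum_congr fun x => ?_
    rw [inv_one, one_smul, map_one]
    exact inner_self_eq_norm_sq (𝕜 := ℂ) _
  have hsumh : ∀ g : Λ, Summable fun x => (‖f (g⁻¹ • x)‖ ^ 2 + ‖f x‖ ^ 2) / 2 -
      (⟪σ g (f (g⁻¹ • x)), f x⟫_ℂ).re := fun g =>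
    (((hsumg g).add hsum).div_const 2).sub (hsumr g)
  have hD : ∀ g : Λ, ∑' x, ((‖f (g⁻¹ • x)‖ ^ 2 + ‖f x‖ ^ 2) / 2 -
      (⟪σ g (f (g⁻¹ • x)), f x⟫_ℂ).re) = Q - (kernelForm (subgroupChar H) σ g s v).re := fun g => by
    rw [(((hsumg g).add hsum).div_const 2).tsum_sub (hsumr g), tsum_div_const,
      (hsumg g).tsum_add hsum, htsg, hB]
    ring
  have hDnn : ∀ g : Λ, 0 ≤ Q - (kernelForm (subgroupChar H) σ g s v).re := fun g => by
    rw [← hD]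
    refine tsum_nonneg fun x => ?_
    have h1 := norm_sub_sq (𝕜 := ℂ) (σ g (f (g⁻¹ • x))) (f x)
    rw [LinearIsometryEquiv.norm_map] at h1
    have h2 := sq_nonneg ‖σ g (f (g⁻¹ • x)) - f x‖
    have h3 : RCLike.re ⟪σ g (f (g⁻¹ • x)), f x⟫_ℂ = (⟪σ g (f (g⁻¹ • x)), f x⟫_ℂ).re := rfl
    linarith
  rw [hB1] at hlt
  have hQnn : 0 ≤ Q := tsum_nonneg fun x => sq_nonneg _
  -- Strictness in `approxInvariant` excludes the zero vector: the defects are nonnegative.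
  have hQpos : 0 < Q := by
    rcases hQnn.lt_or_eq with h | h
    · exact h
    · rw [← h] at hlt
      have := Finset.sum_nonneg fun g (_ : g ∈ F) => hDnn g
      rw [← h] at this
      simp only [mul_zero] at hlt
      exact absurd hlt (not_lt.2 this)
  refine ⟨fun x => ‖f x‖ ^ 2 / Q, hfin.subset fun x hx hx' => hx (by simp only [hx', zero_div]),
    fun x => by positivity, by rw [tsum_div_const, ← hQ, div_self hQpos.ne'], fun g hg => ?_⟩
  have hg1 : Q - (kernelForm (subgroupChar H) σ g s v).re ≤ (δ / 3) ^ 2 * Q :=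
    (Finset.single_le_sum (f := fun g => Q - (kernelForm (subgroupChar H) σ g s v).re)
      (fun g _ => hDnn g) hg).trans (hlt.le.trans (mul_le_mul_of_nonneg_right hN.le hQnn))
  have hpt : ∀ x, |‖f (g⁻¹ • x)‖ ^ 2 / Q - ‖f x‖ ^ 2 / Q| ≤
      ((1 / (δ / 3)) * ((‖f (g⁻¹ • x)‖ ^ 2 + ‖f x‖ ^ 2) / 2 -
        (⟪σ g (f (g⁻¹ • x)), f x⟫_ℂ).re) +
      (δ / 3) * (‖f (g⁻¹ • x)‖ ^ 2 + ‖f x‖ ^ 2)) / Q := fun x => by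
    rw [← sub_div, abs_div, abs_of_pos hQpos]
    refine div_le_div_of_nonneg_right ?_ hQnn
    simpa only [LinearIsometryEquiv.norm_map] using
      abs_norm_sq_sub_le (σ g (f (g⁻¹ • x))) (f x) (by positivity : 0 < δ / 3)
  have s1 := (hsumh g).mul_left (1 / (δ / 3))
  have s2 := ((hsumg g).add hsum).mul_left (δ / 3)
  refine ((((hsumg g).div_const Q).sub (hsum.div_const Q)).abs.tsum_le_tsum hpt
    ((s1.add s2).div_const Q)).trans ?_
  rw [tsum_div_const, s1.tsum_add s2, tsum_mul_left, tsum_mul_left, hD, (hsumg g).tsum_add hsum,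
    htsg, div_le_iff₀ hQpos]
  have : 1 / (δ / 3) * (Q - (kernelForm (subgroupChar H) σ g s v).re) ≤ δ / 3 * Q := by
    rw [div_mul_eq_mul_div, one_mul, div_le_iff₀ (by positivity)]
    linarith
  linarith

end Form

/-! ### Tensor products with a cyclic representation -/

section Tensor

variable {Λ : Type*} [Group Λ] {H V : Type*} [NormedAddCommGroup H] [InnerProductSpace ℂ H]
  [NormedAddCommGroup V] [InnerProductSpace ℂ V]

/-- The vector `∑ᵢ π(sᵢ) ξ ⊗ vᵢ` of the Hilbert space tensor product. -/
def cyclicTensor (π : UnitaryRep Λ H) (ξ : H) {n : ℕ} (s : Fin n → Λ) (v : Fin n → V) :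
    HilbertTensor H V :=
  ((∑ i, π (s i) ξ ⊗ₜ[ℂ] v i : H ⊗[ℂ] V) : HilbertTensor H V)

theorem tensor_apply_coe (π : UnitaryRep Λ H) (σ : UnitaryRep Λ V) (g : Λ) (t : H ⊗[ℂ] V) :
    π.tensor σ g (t : HilbertTensor H V) =
      ((TensorProduct.mapIsometry (π g).toLinearIsometry (σ g).toLinearIsometry t : H ⊗[ℂ] V) :
        HilbertTensor H V) :=
  completionIsometry_coe _ t

/-- On these vectors `π ⊗ σ` depends on `π` through `φ` alone, which allows `φ` to be disintegrated
later. -/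
theorem inner_tensor_cyclicTensor {φ : Λ → ℂ} {π : UnitaryRep Λ H} {ξ : H}
    (hφ : IsGNSTriplet φ π ξ) (σ : UnitaryRep Λ V) (g : Λ) {n : ℕ} (s : Fin n → Λ)
    (v : Fin n → V) :
    ⟪π.tensor σ g (cyclicTensor π ξ s v), cyclicTensor π ξ s v⟫_ℂ = kernelForm φ σ g s v := by
  rw [cyclicTensor, tensor_apply_coe, UniformSpace.Completion.inner_coe, map_sum, sum_inner]
  refine Finset.sum_congr rfl fun i _ => ?_
  rw [inner_sum]
  refine Finset.sum_congr rfl fun j _ => ?_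
  rw [TensorProduct.mapIsometry_apply, TensorProduct.map_tmul, TensorProduct.inner_tmul,
    hφ.apply_eq]
  congr 1
  change ⟪π g (π (s i) ξ), π (s j) ξ⟫_ℂ = _
  rw [← LinearIsometryEquiv.inner_map_map (π (g * s i)) ξ]
  have h1 : ∀ a b : Λ, ∀ x, π (a * b) x = π a (π b x) := fun a b x => by rw [map_mul]; rfl
  rw [← h1, ← h1, mul_inv_cancel_left]

/-- Cyclicity of `ξ` approximates `x ⊗ y` by continuity in `x`. Scalars are absorbed into the `vᵢ`,
so the set already contains the span of the `π(s) ξ ⊗ v`. -/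
theorem mem_closure_cyclicTensor {φ : Λ → ℂ} {π : UnitaryRep Λ H} {ξ : H}
    (hφ : IsGNSTriplet φ π ξ) (w : HilbertTensor H V) :
    w ∈ closure {w | ∃ (n : ℕ) (s : Fin n → Λ) (v : Fin n → V), cyclicTensor π ξ s v = w} := by
  set S : Submodule ℂ (HilbertTensor H V) := Submodule.span ℂ
    (Set.range fun p : Λ × V => ((π p.1 ξ ⊗ₜ[ℂ] p.2 : H ⊗[ℂ] V) : HilbertTensor H V)) with hS
  have hsub : (S : Set (HilbertTensor H V)) ⊆
      {w | ∃ (n : ℕ) (s : Fin n → Λ) (v : Fin n → V), cyclicTensor π ξ s v = w} := by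
    intro w hw
    obtain ⟨n, c, p, rfl⟩ := Submodule.mem_span_set'.1 hw
    choose q hq using fun i => (p i).2
    refine ⟨n, fun i => (q i).1, fun i => c i • (q i).2, ?_⟩
    rw [cyclicTensor]
    have : ∀ t : H ⊗[ℂ] V, (t : HilbertTensor H V) =
      UniformSpace.Completion.toComplL (𝕜 := ℂ) t := fun _ => rfl
    rw [this, map_sum]
    refine Finset.sum_congr rfl fun i _ => ?_
    rw [TensorProduct.tmul_smul, map_smul, ← hq i]
    rfl
  refine closure_mono hsub ?_
  have hcoe : ∀ t : H ⊗[ℂ] V, (t : HilbertTensor H V) ∈ S.topologicalClosure := by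
    intro t
    induction t with
    | zero =>
      rw [UniformSpace.Completion.coe_zero]
      exact zero_mem _
    | add x y hx hy =>
      rw [UniformSpace.Completion.coe_add]
      exact add_mem hx hy
    | tmul x y =>
      let f : H →L[ℂ] HilbertTensor H V :=
        (UniformSpace.Completion.toComplL (𝕜 := ℂ)).comp
          (LinearMap.mkContinuous ((TensorProduct.mk ℂ H V).flip y) ‖y‖ fun x => by
            rw [LinearMap.flip_apply, TensorProduct.mk_apply, TensorProduct.norm_tmul, mul_comm])
      have hx : x ∈ (Submodule.span ℂ (Set.range fun g : Λ => π g ξ)).topologicalClosure := by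
        rw [hφ.cyclic]; exact Submodule.mem_top
      have hm : Set.MapsTo f (Submodule.span ℂ (Set.range fun g : Λ => π g ξ)) S := by
        intro z hz
        have hle : Submodule.span ℂ (Set.range fun g : Λ => π g ξ) ≤ S.comap f.toLinearMap := by
          rw [Submodule.span_le]
          rintro _ ⟨g, rfl⟩
          exact Submodule.subset_span ⟨(g, y), rfl⟩
        exact hle hz
      exact (map_mem_closure f.continuous hx hm : f x ∈ closure (S : Set (HilbertTensor H V)))
  induction w using UniformSpace.Completion.induction_on with
  | hp => exact isClosed_closure
  | ih t => exact hcoe t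

/-- If the matrix coefficients of `π ⊗ σ` at the vectors `∑ᵢ π(sᵢ) ξ ⊗ vᵢ` are uniformly far from
being invariant, then `π ⊗ σ` has no almost invariant vectors. -/
theorem exists_kernelForm_lt {φ : Λ → ℂ} {π : UnitaryRep Λ H} {ξ : H} (hφ : IsGNSTriplet φ π ξ)
    (σ : UnitaryRep Λ V) (h : HasAlmostInvariantVectors (π.tensor σ)) (F : Finset Λ) {ε : ℝ}
    (hε : 0 < ε) : ∃ (n : ℕ) (s : Fin n → Λ) (v : Fin n → V),
      ∑ g ∈ F, ((kernelForm φ σ 1 s v).re - (kernelForm φ σ g s v).re) <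
        ε * (kernelForm φ σ 1 s v).re := by
  by_contra! hcon
  set ρ := π.tensor σ with hρ
  -- Since `‖ρ(g) w - w‖² / 2 = ‖w‖² - Re ⟨ρ(g) w, w⟩`, the negated conclusion is this inequality on
  -- a dense set. It is a closed condition, so it extends to all `w`, against almost invariance.
  have hw : ∀ w : HilbertTensor H V, ε * ‖w‖ ^ 2 ≤ ∑ g ∈ F, ‖ρ g w - w‖ ^ 2 / 2 := by
    intro w
    have hclosed : IsClosed {w : HilbertTensor H V |
        ε * ‖w‖ ^ 2 ≤ ∑ g ∈ F, ‖ρ g w - w‖ ^ 2 / 2} :=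
      isClosed_le (by fun_prop) (continuous_finsetSum _ fun g _ =>
        ((((ρ g).continuous.sub continuous_id).norm.pow 2).div_const 2))
    refine closure_minimal ?_ hclosed (mem_closure_cyclicTensor hφ w)
    rintro _ ⟨n, s, v, rfl⟩
    have h1 : (kernelForm φ σ 1 s v).re = ‖cyclicTensor π ξ s v‖ ^ 2 := by
      rw [← inner_tensor_cyclicTensor hφ, map_one]
      exact inner_self_eq_norm_sq (𝕜 := ℂ) _
    have h2 : ∀ g, ‖ρ g (cyclicTensor π ξ s v) - cyclicTensor π ξ s v‖ ^ 2 / 2 =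
        (kernelForm φ σ 1 s v).re - (kernelForm φ σ g s v).re := by
      intro g
      rw [norm_sub_sq (𝕜 := ℂ), LinearIsometryEquiv.norm_map, h1, hρ,
        inner_tensor_cyclicTensor hφ]
      change (_ - 2 * (kernelForm φ σ g s v).re + _) / 2 = _
      ring
    simp only [Set.mem_ofPred_eq, h2, ← h1]
    exact hcon n s v
  obtain ⟨v, hv1, hv⟩ := h
  have hlim : Tendsto (fun n => ∑ g ∈ F, ‖ρ g (v n) - v n‖ ^ 2 / 2) atTop (𝓝 0) := by
    have := tendsto_finsetSum F fun g _ => ((hv g).pow 2).div_const 2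
    simpa using this
  refine absurd (ge_of_tendsto' (b := ε) hlim fun n => ?_) (not_le.2 hε)
  have := hw (v n)
  rwa [hv1, one_pow, mul_one] at this

end Tensor

/-! ### Ergodicity -/

section Action

variable {Λ : Type*} [Group Λ] {Ω : Type*} [MeasurableSpace Ω] [MulAction Λ Ω]
  [MeasurableConstSMul Λ Ω] (ν : Measure Ω) [SMulInvariantMeasure Λ Ω ν]

/-- If `B` is neither null nor conull, then `1_B - ν(B)` is a nonzero invariant vector of `L²₀`;
normalized, it gives a constant almost invariant sequence. -/
theorem ae_mem_or_ae_notMem_of_hasSpectralGap [IsProbabilityMeasure ν] (hgap : HasSpectralGap Λ ν)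
    {B : Set Ω} (hB : NullMeasurableSet B ν) (hinv : ∀ (g : Λ) (ω : Ω), g • ω ∈ B ↔ ω ∈ B) :
    (∀ᵐ ω ∂ν, ω ∈ B) ∨ ∀ᵐ ω ∂ν, ω ∉ B := by
  classical
  by_contra hne
  apply hgap
  set c : ℂ := (ν.real B : ℂ) with hc
  set f : Ω → ℂ := fun ω => B.indicator (fun _ => (1 : ℂ)) ω - c with hf
  have hfm : AEStronglyMeasurable f ν :=
    ((aestronglyMeasurable_const (b := (1 : ℂ))).indicator₀ hB).sub aestronglyMeasurable_const
  have hbound : ∀ ω, ‖f ω‖ ≤ 1 + ‖c‖ := fun ω => by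
    refine (norm_sub_le _ _).trans (add_le_add_left ?_ _)
    by_cases h : ω ∈ B <;> simp [h]
  have hfL : MemLp f 2 ν := MemLp.of_bound hfm (1 + ‖c‖) (ae_of_all _ hbound)
  set F : Lp ℂ 2 ν := hfL.toLp f with hF
  have hint : ∫ ω, f ω ∂ν = 0 := by
    rw [hf, integral_sub ((integrable_const (1 : ℂ)).indicator₀ hB) (integrable_const c),
      integral_indicator₀ hB]
    simp [hc]
  have hF0 : F ∈ LTwoZero ν := by
    rw [LTwoZero, Submodule.mem_orthogonal]
    intro u hu
    induction hu using Submodule.span_induction with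
    | mem x hx =>
      obtain ⟨a, rfl⟩ := hx
      rw [L2.inner_def]
      have : (fun ω => ⟪(Lp.const 2 ν a : Lp ℂ 2 ν) ω, F ω⟫_ℂ) =ᵐ[ν] fun ω => f ω * conj a := by
        filter_upwards [Lp.coeFn_const (p := 2) (μ := ν) a, hfL.coeFn_toLp] with ω h1 h2
        rw [h1, h2]
        rfl
      rw [integral_congr_ae this, integral_mul_const, hint, zero_mul]
    | zero => exact inner_zero_left _
    | add x y _ _ hx hy => rw [inner_add_left, hx, hy, add_zero]
    | smul a x _ hx => rw [inner_smul_left, hx, mul_zero]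
  have hFinv : ∀ g : Λ, koopman Λ ν g F = F := by
    intro g
    change Lp.compMeasurePreserving (fun ω : Ω => g⁻¹ • ω) (measurePreserving_smul g⁻¹ ν) F = F
    rw [hF, Lp.toLp_compMeasurePreserving]
    congr 1
    ext ω
    simp only [hf, Function.comp, Set.indicator_apply, hinv]
  have hFne : F ≠ 0 := by
    intro h0
    apply hne
    have hae : f =ᵐ[ν] 0 := by
      have h1 := hfL.coeFn_toLp
      rw [← hF, h0] at h1
      exact h1.symm.trans (Lp.coeFn_zero ℂ 2 ν)
    -- If `f` vanishes a.e., then `B` is null when `c = 0`, as `f = 1` on `B`; otherwise `B` is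
    -- conull, as `f = -c ≠ 0` off `B`.
    by_cases h1 : c = 0
    · right
      filter_upwards [hae] with ω hω hωB
      simp [hf, hωB, h1] at hω
    · left
      filter_upwards [hae] with ω hω
      by_contra hωB
      simp [hf, hωB, h1] at hω
  set F' : LTwoZero ν := ⟨F, hF0⟩ with hF'
  have hF'ne : F' ≠ 0 := fun h => hFne (congrArg Subtype.val h)
  refine ⟨fun _ => ((‖F'‖⁻¹ : ℝ) : ℂ) • F', fun _ => ?_, fun g => ?_⟩
  · rw [norm_smul, Complex.norm_real, norm_inv, norm_norm,
      inv_mul_cancel₀ (norm_ne_zero_iff.2 hF'ne)]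
  · have : koopmanZero Λ ν g F' = F' := Subtype.ext (hFinv g)
    simp only [map_smul, this, sub_self, norm_zero]
    exact tendsto_const_nhds

end Action

/-! ### The trace of a probability measure preserving action -/

section ActionTrace

variable {Λ : Type*} [Group Λ] {Ω : Type*} [MeasurableSpace Ω] [MulAction Λ Ω] (ν : Measure Ω)

variable (Λ) in
/-- The trace `g ↦ ν {ω | g ω = ω}`. -/
def actionTrace (g : Λ) : ℂ :=
  ∫ ω, subgroupChar (MulAction.stabilizer Λ ω) g ∂ν

theorem integrable_subgroupChar_stabilizer [IsFiniteMeasure ν]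
    (hstab : AEMeasurable (fun ω : Ω => MulAction.stabilizer Λ ω) ν) (g : Λ) :
    Integrable (fun ω : Ω => subgroupChar (MulAction.stabilizer Λ ω) g) ν := by
  refine Integrable.of_bound
    ((continuous_subgroupChar g).measurable.comp_aemeasurable hstab).aestronglyMeasurable 1
    (ae_of_all _ fun ω => ?_)
  by_cases h : g ∈ MulAction.stabilizer Λ ω
  · rw [subgroupChar, if_pos h, norm_one]
  · rw [subgroupChar, if_neg h, norm_zero]
    exact zero_le_one

section Form

variable [IsFiniteMeasure ν] (hstab : AEMeasurable (fun ω : Ω => MulAction.stabilizer Λ ω) ν)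
  {V : Type*} [NormedAddCommGroup V] [InnerProductSpace ℂ V] (σ : UnitaryRep Λ V) (g : Λ) {n : ℕ}
  (s : Fin n → Λ) (v : Fin n → V)

include hstab

theorem integrable_kernelForm_stabilizer :
    Integrable (fun ω : Ω => kernelForm (subgroupChar (MulAction.stabilizer Λ ω)) σ g s v) ν :=
  integrable_finsetSum _ fun _ _ => integrable_finsetSum _ fun _ _ =>
    (integrable_subgroupChar_stabilizer ν hstab _).mul_const _

/-- Linearity of the form in its kernel; this replaces the direct integral decomposition. -/
theorem kernelForm_actionTrace :
    kernelForm (actionTrace Λ ν) σ g s v =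
      ∫ ω, kernelForm (subgroupChar (MulAction.stabilizer Λ ω)) σ g s v ∂ν := by
  have hi : ∀ i j, Integrable (fun ω : Ω => subgroupChar (MulAction.stabilizer Λ ω)
      ((g * s i)⁻¹ * s j) * ⟪σ g (v i), v j⟫_ℂ) ν := fun i j =>
    (integrable_subgroupChar_stabilizer ν hstab _).mul_const _
  simp only [kernelForm]
  rw [integral_finsetSum _ fun i _ => integrable_finsetSum _ fun j _ => hi i j]
  refine Finset.sum_congr rfl fun i _ => ?_
  rw [integral_finsetSum _ fun j _ => hi i j]
  exact Finset.sum_congr rfl fun j _ => (integral_mul_const _ _).symm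

theorem re_kernelForm_actionTrace :
    (kernelForm (actionTrace Λ ν) σ g s v).re =
      ∫ ω, (kernelForm (subgroupChar (MulAction.stabilizer Λ ω)) σ g s v).re ∂ν := by
  rw [kernelForm_actionTrace ν hstab]
  exact (Complex.reCLM.integral_comp_comm
    (integrable_kernelForm_stabilizer ν hstab σ g s v)).symm

end Form

theorem isTrace_actionTrace [IsProbabilityMeasure ν] [MeasurableConstSMul Λ Ω]
    [SMulInvariantMeasure Λ Ω ν]
    (hstab : AEMeasurable (fun ω : Ω => MulAction.stabilizer Λ ω) ν) :
    IsTrace (actionTrace Λ ν) where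
  posDef n g α := by
    -- For the trivial representation on `ℂ`, the form at `1` is the integral over `ω` of the
    -- squared norm of a vector of `ℓ²(Λ ⧸ Λ_ω)`.
    have h : ∑ i, ∑ j, conj (α i) * α j * actionTrace Λ ν ((g i)⁻¹ * g j) =
        kernelForm (actionTrace Λ ν) (1 : UnitaryRep Λ ℂ) 1 g α := by
      refine Finset.sum_congr rfl fun i _ => Finset.sum_congr rfl fun j _ => ?_
      rw [one_mul, mul_comm, mul_comm (conj (α i))]
      rfl
    rw [h, kernelForm_actionTrace ν hstab]
    refine integral_nonneg fun ω => ?_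
    rw [kernelForm_subgroupChar]
    refine tsum_nonneg fun x => ?_
    rw [inv_one, one_smul]
    change 0 ≤ ⟪cosetVector _ g α x, cosetVector _ g α x⟫_ℂ
    rw [inner_self_eq_norm_sq_to_K, RCLike.ofReal_eq_complex_ofReal, ← Complex.ofReal_pow]
    exact Complex.zero_le_real.2 (sq_nonneg _)
  map_one := by
    have : ∀ ω : Ω, subgroupChar (MulAction.stabilizer Λ ω) 1 = 1 := fun ω =>
      if_pos (one_mem _)
    simp [actionTrace, this]
  conj_inv g h := by
    have : ∀ ω : Ω, subgroupChar (MulAction.stabilizer Λ ω) (h * g * h⁻¹) =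
        subgroupChar (MulAction.stabilizer Λ (h⁻¹ • ω)) g := by
      intro ω
      have hm : h * g * h⁻¹ ∈ MulAction.stabilizer Λ ω ↔
          g ∈ MulAction.stabilizer Λ (h⁻¹ • ω) := by
        simp only [MulAction.mem_stabilizer_iff, mul_smul, smul_eq_iff_eq_inv_smul]
      by_cases hg : g ∈ MulAction.stabilizer Λ (h⁻¹ • ω)
      · rw [subgroupChar, subgroupChar, if_pos hg, if_pos (hm.2 hg)]
      · rw [subgroupChar, subgroupChar, if_neg hg, if_neg (mt hm.1 hg)]
    simp only [actionTrace, this]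
    exact integral_smul_eq_self (μ := ν) (g := h⁻¹)
      (fun ω => subgroupChar (MulAction.stabilizer Λ ω) g)

theorem ae_stabilizer_le_of_isSupportedOn [Countable Λ] [IsFiniteMeasure ν]
    (hstab : AEMeasurable (fun ω : Ω => MulAction.stabilizer Λ ω) ν) {N : Subgroup Λ}
    (h : IsSupportedOn (actionTrace Λ ν) N) : ∀ᵐ ω ∂ν, MulAction.stabilizer Λ ω ≤ N := by
  have key : ∀ g : Λ, ∀ᵐ ω ∂ν, g ∈ MulAction.stabilizer Λ ω → g ∈ N := by
    intro g
    by_cases hg : g ∈ N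
    · exact ae_of_all _ fun _ _ => hg
    · have hz := h g hg
      have hnn : ∀ ω : Ω, 0 ≤ (subgroupChar (MulAction.stabilizer Λ ω) g).re := by
        intro ω
        by_cases h : g ∈ MulAction.stabilizer Λ ω <;> simp [subgroupChar, h]
      have hi := integrable_subgroupChar_stabilizer ν hstab g
      have hre : ∫ ω, (subgroupChar (MulAction.stabilizer Λ ω) g).re ∂ν = 0 := by
        rw [← Complex.zero_re, ← hz]
        exact Complex.reCLM.integral_comp_comm hi
      rw [integral_eq_zero_iff_of_nonneg hnn (Complex.reCLM.integrable_comp hi)] at hre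
      filter_upwards [hre] with ω hω hgω
      simp [subgroupChar, MulAction.mem_stabilizer_iff.1 hgω] at hω
  filter_upwards [ae_all_iff.2 key] with ω hω g hg using hω g hg

theorem ae_stabilizer_mem_approxInvariant [IsProbabilityMeasure ν] [MeasurableConstSMul Λ Ω]
    [SMulInvariantMeasure Λ Ω ν] (hgap : HasSpectralGap Λ ν)
    (hstab : AEMeasurable (fun ω : Ω => MulAction.stabilizer Λ ω) ν)
    {H V : Type*} [NormedAddCommGroup H] [InnerProductSpace ℂ H] [NormedAddCommGroup V]
    [InnerProductSpace ℂ V] {π : UnitaryRep Λ H} {ξ : H}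
    (hφ : IsGNSTriplet (actionTrace Λ ν) π ξ) (σ : UnitaryRep Λ V)
    (h : HasAlmostInvariantVectors (π.tensor σ)) (F : Finset Λ) {ε : ℝ} (hε : 0 < ε) :
    ∀ᵐ ω ∂ν, MulAction.stabilizer Λ ω ∈ approxInvariant σ F ε := by
  have hB : NullMeasurableSet
      ((fun ω : Ω => MulAction.stabilizer Λ ω) ⁻¹' approxInvariant σ F ε) ν :=
    hstab.nullMeasurableSet_preimage (isOpen_approxInvariant σ F ε).measurableSet
  refine (ae_mem_or_ae_notMem_of_hasSpectralGap ν hgap hB fun g ω =>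
    ⟨stabilizer_smul_mem_approxInvariant σ F ε g ω, fun hω =>
      stabilizer_smul_mem_approxInvariant σ F ε g⁻¹ (g • ω) ?_⟩).resolve_right fun hne => ?_
  · rwa [inv_smul_smul]
  -- The same data `s`, `v` serve for every `ω`. If almost every `ω` were bad, integrating the
  -- reversed inequality would contradict `hlt`.
  obtain ⟨n, s, v, hlt⟩ := exists_kernelForm_lt hφ σ h F hε
  have hi : ∀ g, Integrable
      (fun ω : Ω => (kernelForm (subgroupChar (MulAction.stabilizer Λ ω)) σ g s v).re) ν :=
    fun g => Complex.reCLM.integrable_comp (integrable_kernelForm_stabilizer ν hstab σ g s v)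
  simp only [re_kernelForm_actionTrace ν hstab] at hlt
  refine absurd hlt (not_lt.2 ?_)
  have hi' : ∀ g, Integrable (fun ω : Ω =>
      (kernelForm (subgroupChar (MulAction.stabilizer Λ ω)) σ 1 s v).re -
        (kernelForm (subgroupChar (MulAction.stabilizer Λ ω)) σ g s v).re) ν :=
    fun g => (hi 1).sub (hi g)
  simp only [← integral_sub (hi 1) (hi _)]
  rw [← integral_finsetSum _ fun g _ => hi' g, ← integral_const_mul]
  refine integral_mono_ae ((hi 1).const_mul ε) (integrable_finsetSum _ fun g _ => hi' g) ?_
  filter_upwards [hne] with ω hω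
  exact not_lt.1 fun hlt => hω ⟨n, s, v, hlt⟩

end ActionTrace

/-- Provides the measurability needed to pass from `ν` to its pushforward. -/
theorem isClosed_setOf_le {Λ : Type*} [Group Λ] (N : Subgroup Λ) :
    IsClosed {H : Subgroup Λ | H ≤ N} := by
  have : {H : Subgroup Λ | H ≤ N} = ⋂ g ∈ (N : Set Λ)ᶜ, {H | subgroupChar H g = 0} := by
    ext H
    simp only [Set.mem_ofPred_eq, Set.mem_iInter, Set.mem_compl_iff, SetLike.mem_coe]
    refine ⟨fun h g hg => if_neg fun hgH => hg (h hgH), fun h g hgH => ?_⟩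
    by_contra hg
    have := h g hg
    rw [subgroupChar, if_pos hgH] at this
    exact one_ne_zero this
  rw [this]
  exact isClosed_biInter fun g _ => isClosed_eq (continuous_subgroupChar g) continuous_const

end CharmIRS

end

theorem mainTheorem7 {Λ : Type*} [Group Λ] [Countable Λ]
    (htrace : ∀ φ : Λ → ℂ, CharmIRS.IsTrace φ →
      CharmIRS.IsAmenableTrace φ ∨ CharmIRS.IsSupportedOn φ (CharmIRS.amenableRadical Λ))
    {Ω : Type*} [MeasurableSpace Ω] (ν : Measure Ω) [IsProbabilityMeasure ν]
    [MulAction Λ Ω] [MeasurableConstSMul Λ Ω] [SMulInvariantMeasure Λ Ω ν]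
    (hstab : AEMeasurable (fun ω : Ω => MulAction.stabilizer Λ ω) ν)
    (hgap : CharmIRS.HasSpectralGap Λ ν) :
    ((∀ᵐ ω ∂ν, MulAction.stabilizer Λ ω ≤ CharmIRS.amenableRadical Λ) ∨
      (∀ᵐ ω ∂ν, CharmIRS.IsCoamenable (MulAction.stabilizer Λ ω))) ∧
    ((∀ᵐ H ∂(CharmIRS.stabilizerIRS Λ ν), H ≤ CharmIRS.amenableRadical Λ) ∨
      (∀ᵐ H ∂(CharmIRS.stabilizerIRS Λ ν), CharmIRS.IsCoamenable H)) := by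
  rcases htrace _ (CharmIRS.isTrace_actionTrace ν hstab) with hφ | hφ
  · obtain ⟨H, _, _, _, π, ξ, hGNS, hπ⟩ := hφ
    have hmem : ∀ᵐ ω ∂ν, MulAction.stabilizer Λ ω ∈ ⋂ (F : Finset Λ) (n : ℕ),
        CharmIRS.approxInvariant π.dual F (1 / ((n : ℝ) + 1)) := by
      simp only [Set.mem_iInter]
      exact ae_all_iff.2 fun F => ae_all_iff.2 fun n =>
        CharmIRS.ae_stabilizer_mem_approxInvariant ν hgap hstab hGNS π.dual hπ F (by positivity)
    -- The transfer to the pushforward needs a measurable set, so it is made for this countable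
    -- intersection of open sets, all of whose members are co-amenable, rather than for the set of
    -- co-amenable subgroups itself.
    have hmeas : MeasurableSet (⋂ (F : Finset Λ) (n : ℕ),
        CharmIRS.approxInvariant π.dual F (1 / ((n : ℝ) + 1))) :=
      MeasurableSet.iInter fun F => MeasurableSet.iInter fun n =>
        (CharmIRS.isOpen_approxInvariant _ _ _).measurableSet
    have hco : ∀ K ∈ ⋂ (F : Finset Λ) (n : ℕ),
        CharmIRS.approxInvariant π.dual F (1 / ((n : ℝ) + 1)), CharmIRS.IsCoamenable K :=
      fun K hK => CharmIRS.isCoamenable_of_approxInvariant π.dual K fun F n =>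
        Set.mem_iInter.1 (Set.mem_iInter.1 hK F) n
    exact ⟨Or.inr (hmem.mono fun ω => hco _),
      Or.inr (((ae_map_iff hstab hmeas).2 hmem).mono fun K => hco K)⟩
  · have hle := CharmIRS.ae_stabilizer_le_of_isSupportedOn ν hstab hφ
    exact ⟨Or.inl hle,
      Or.inl ((ae_map_iff hstab (CharmIRS.isClosed_setOf_le _).measurableSet).2 hle)⟩
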